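/- Let $X\in\mathbb{R}^{N\times d}$ have rank $r$ and let $X=U\Sigma V^{\mathsf T}$ be a singular value decomposition, where $U\in\mathbb{R}^{N\times r}$ and $V\in\mathbb{R}^{d\times r}$ have orthonormal columns and $\Sigma\in\mathbb{R}^{r\times r}$ is diagonal with positive diagonal entries $\sigma_1\ge\dots\ge\sigma_r>0$. Let $1\le k\le r$ and let $V_k=V_{:,[k]}\in\mathbb{R}^{d\times k}$ consist of the first $k$ columns of $V$. For $\nu\in\{2,\mathrm{Fr}\}$ let $\|\cdot\|_\nu$ be the spectral norm, respectively the Frobenius norm. Let $\Pi_kX$ be a best approximation of $X$ among the matrices of rank at most $k$, where "best" may be understood in either of the two norms. For $S\subset[d]$ with $|S|=k$ let $\Pi_S^\nu X$ be a minimizer of $\|X-A\|_\nu$ over all the matrices $A=X_{:,S}B$ with $B\in\mathbb{R}^{k\times d}$ and $\operatorname{rank}B\le k$. There is a determinantal point process on $[d]$ with marginal kernel $K=V_kV_k^{\mathsf T}$, that is, a random subset $S$ of $[d]$ such that $\mathbb{P}(T\subset S)=\det\big((K_{i,j})_{i,j\in T}\big)$ for all $T\subset[d]$. Every such random subset satisfies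 $|S|=k$ almost surely and $$\mathbb{P}(S=T)=\det(V_{T,[k]})^2\qquad\text{for all } T\subset[d] \text{ with } |T|=k,$$ and, for both $\nu\in\{2,\mathrm{Fr}\}$, $$\mathbb{E}\,\|X-\Pi_S^\nu X\|_\nu^2\le k(d+1-k)\,\|X-\Pi_kX\|_\nu^2 .$$ -/

import Mathlib

/-- The two matrix norms under consideration. -/
inductive NormKind where
  | spectral
  | frobenius

/-- The spectral norm (the operator norm between Euclidean spaces, i.e. the largest singular value)
or the Frobenius norm of a real matrix. -/
noncomputable def matNorm {m n : ℕ} (ν : NormKind) (A : Matrix (Fin m) (Fin n) ℝ) : ℝ :=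
  match ν with
  | .spectral => Matrix.instL2OpNormedAddCommGroup.toNorm.norm A
  | .frobenius => Matrix.frobeniusNormedAddCommGroup.toNorm.norm A

/-- `X = U Σ Vᵀ` is a (compact) singular value decomposition of `X`: the columns of `U` and of `V`
are orthonormal, and `Σ` is the diagonal matrix of the positive singular values `σ`, in
non-increasing order; in particular `r` is the rank of `X`. -/
structure IsSVD {N d r : ℕ} (X : Matrix (Fin N) (Fin d) ℝ) (U : Matrix (Fin N) (Fin r) ℝ)
    (σ : Fin r → ℝ) (V : Matrix (Fin d) (Fin r) ℝ) : Prop where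
  orthonormal_left : U.transpose * U = 1
  orthonormal_right : V.transpose * V = 1
  pos : ∀ i, 0 < σ i
  antitone : Antitone σ
  eq : X = U * Matrix.diagonal σ * V.transpose

/-- `A` is a best approximation of `X` by matrices of rank at most `k`, for the norm `ν`. -/
def IsBestRankApprox {N d : ℕ} (ν : NormKind) (k : ℕ) (X A : Matrix (Fin N) (Fin d) ℝ) : Prop :=
  A.rank ≤ k ∧
    ∀ A' : Matrix (Fin N) (Fin d) ℝ, A'.rank ≤ k → matNorm ν (X - A) ≤ matNorm ν (X - A')

/-- The submatrix of the columns of `X` with index in `S`. -/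
def colSubmatrix {N d : ℕ} (X : Matrix (Fin N) (Fin d) ℝ) (S : Finset (Fin d)) :
    Matrix (Fin N) S ℝ :=
  X.submatrix id (fun i : S => (i : Fin d))

/-- `A` minimizes `‖X - A‖_ν` over all the matrices `A = X_{:,S} B` with `rank B ≤ k`. -/
def IsBestColumnApprox {N d : ℕ} (ν : NormKind) (k : ℕ) (X : Matrix (Fin N) (Fin d) ℝ)
    (S : Finset (Fin d)) (A : Matrix (Fin N) (Fin d) ℝ) : Prop :=
  (∃ B : Matrix S (Fin d) ℝ, B.rank ≤ k ∧ A = colSubmatrix X S * B) ∧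
    ∀ B : Matrix S (Fin d) ℝ, B.rank ≤ k →
      matNorm ν (X - A) ≤ matNorm ν (X - colSubmatrix X S * B)

/-- `V_k`, the first `k` columns of `V`. -/
def firstCols {d r k : ℕ} (hkr : k ≤ r) (V : Matrix (Fin d) (Fin r) ℝ) :
    Matrix (Fin d) (Fin k) ℝ :=
  V.submatrix id (Fin.castLE hkr)

/-- `W_{S,:}`, the square submatrix of the rows of `W` with index in `S`, in increasing order. -/
def rowSubmatrix {d k : ℕ} (W : Matrix (Fin d) (Fin k) ℝ) (S : Finset (Fin d))
    (hS : S.card = k) : Matrix (Fin k) (Fin k) ℝ :=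
  W.submatrix (S.orderEmbOfFin hS) id

/-- `p`, the law of a random subset `Y` of `Fin d`, is a determinantal point process of marginal
kernel `K`: `ℙ(S ⊆ Y) = det K_S` for every `S`. -/
def IsDPP {d : ℕ} (p : PMF (Finset (Fin d))) (K : Matrix (Fin d) (Fin d) ℝ) : Prop :=
  ∀ S : Finset (Fin d),
    (∑ Y : Finset (Fin d) with S ⊆ Y, (p Y).toReal) =
      (K.submatrix (fun i : S => (i : Fin d)) (fun i : S => (i : Fin d))).det

/-- The expectation of `f Y` for a random subset `Y` of `Fin d` with law `p`. -/
noncomputable def expectation {d : ℕ} (p : PMF (Finset (Fin d))) (f : Finset (Fin d) → ℝ) : ℝ :=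
  ∑ Y : Finset (Fin d), (p Y).toReal * f Y

theorem exists_closest {E : Type*} [NormedAddCommGroup E] [NormedSpace ℝ E]
    [FiniteDimensional ℝ E] (C : Set E) (hC : IsClosed C) (hne : C.Nonempty) (x : E) :
    ∃ a ∈ C, ∀ b ∈ C, ‖x - a‖ ≤ ‖x - b‖ := by
  have := FiniteDimensional.proper ℝ E
  obtain ⟨a, ha, h⟩ := hC.exists_infDist_eq_dist hne x
  refine ⟨a, ha, fun b hb => ?_⟩
  rw [← dist_eq_norm, ← dist_eq_norm, ← h]
  exact Metric.infDist_le_dist_of_mem hb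

theorem isClosed_rank_le {m n : ℕ} {E : Type*} [NormedAddCommGroup E] [NormedSpace ℝ E]
    [FiniteDimensional ℝ E] (e : E →ₗ[ℝ] Matrix (Fin m) (Fin n) ℝ) (k : ℕ) :
    IsClosed {x : E | (e x).rank ≤ k} := by
  let g : E →ₗ[ℝ] ((Fin n → ℝ) →L[ℝ] (Fin m → ℝ)) :=
    (LinearMap.toContinuousLinearMap.toLinearMap ∘ₗ (Matrix.toLin'.toLinearMap)) ∘ₗ e
  have h1 := (isOpen_setOfPred_nat_le_rank (𝕜 := ℝ) (E := Fin n → ℝ) (F := Fin m → ℝ) (k+1)).preimage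
    (LinearMap.continuous_of_finiteDimensional g)
  rw [← isOpen_compl_iff]
  convert h1 using 1
  ext x
  simp only [Set.mem_compl_iff, Set.mem_ofPred_eq, not_le, Set.mem_preimage]
  have : (e x).rank = Module.finrank ℝ (LinearMap.range (Matrix.toLin' (e x))) := by
    rw [Matrix.rank, Matrix.toLin'_apply']
  rw [this]
  change _ ↔ ((k+1 : ℕ) : Cardinal) ≤ (Matrix.toLin' (e x)).rank
  rw [LinearMap.rank, ← Module.finrank_eq_rank, Nat.cast_le]
  rfl

/-- Best approximations of rank at most `k` exist. -/
theorem exists_isBestRankApprox {N d : ℕ} (ν : NormKind) (k : ℕ)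
    (X : Matrix (Fin N) (Fin d) ℝ) : ∃ A, IsBestRankApprox ν k X A := by
  cases ν with
  | spectral =>
    let _ := Matrix.instL2OpNormedAddCommGroup (m := Fin N) (n := Fin d) (𝕜 := ℝ)
    let _ := Matrix.instL2OpNormedSpace (m := Fin N) (n := Fin d) (𝕜 := ℝ)
    exact exists_closest {A : Matrix (Fin N) (Fin d) ℝ | A.rank ≤ k}
      (isClosed_rank_le ⟨⟨fun A => A, fun _ _ => rfl⟩, fun _ _ => rfl⟩ k) ⟨0, by simp⟩ X
  | frobenius =>
    let _ := Matrix.frobeniusNormedAddCommGroup (m := Fin N) (n := Fin d) (α := ℝ)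
    let _ := Matrix.frobeniusNormedSpace (m := Fin N) (n := Fin d) (R := ℝ) (α := ℝ)
    exact exists_closest {A : Matrix (Fin N) (Fin d) ℝ | A.rank ≤ k}
      (isClosed_rank_le ⟨⟨fun A => A, fun _ _ => rfl⟩, fun _ _ => rfl⟩ k) ⟨0, by simp⟩ X

/-- Best approximations from `k` given columns exist. -/
theorem exists_isBestColumnApprox {N d : ℕ} (ν : NormKind) (k : ℕ)
    (X : Matrix (Fin N) (Fin d) ℝ) (S : Finset (Fin d)) (hS : S.card = k) :
    ∃ A, IsBestColumnApprox ν k X S A := by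
  have hr : ∀ B : Matrix S (Fin d) ℝ, B.rank ≤ k := fun B =>
    (B.rank_le_card_height).trans (by simp [hS])
  let L : Matrix S (Fin d) ℝ →ₗ[ℝ] Matrix (Fin N) (Fin d) ℝ :=
    { toFun := fun B => colSubmatrix X S * B
      map_add' := fun a b => Matrix.mul_add _ a b
      map_smul' := fun c a => Matrix.mul_smul _ c a }
  have key : ∃ a ∈ (LinearMap.range L : Set (Matrix (Fin N) (Fin d) ℝ)),
      ∀ b ∈ (LinearMap.range L : Set (Matrix (Fin N) (Fin d) ℝ)),
        matNorm ν (X - a) ≤ matNorm ν (X - b) := by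
    cases ν with
    | spectral =>
      let _ := Matrix.instL2OpNormedAddCommGroup (m := Fin N) (n := Fin d) (𝕜 := ℝ)
      let _ := Matrix.instL2OpNormedSpace (m := Fin N) (n := Fin d) (𝕜 := ℝ)
      exact exists_closest _ (LinearMap.range L).closed_of_finiteDimensional ⟨0, by simp⟩ X
    | frobenius =>
      let _ := Matrix.frobeniusNormedAddCommGroup (m := Fin N) (n := Fin d) (α := ℝ)
      let _ := Matrix.frobeniusNormedSpace (m := Fin N) (n := Fin d) (R := ℝ) (α := ℝ)
      exact exists_closest _ (LinearMap.range L).closed_of_finiteDimensional ⟨0, by simp⟩ X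
  obtain ⟨a, ⟨B, rfl⟩, h⟩ := key
  exact ⟨_, ⟨B, hr B, rfl⟩, fun B' _ => h _ ⟨B', rfl⟩⟩

/-! Write W = V_k and K = W Wᵀ. By Cauchy–Binet the weights det K_S, |S| = k, sum to det(WᵀW) = 1.
Inclusion–exclusion shows that they have the marginals prescribed by K, and Möbius inversion shows
that no other law has them.

For a set S of nonzero weight, let P be the oblique projection onto the coordinates in S along ker
Wᵀ. Then KP = K, so X - XP = (X - XK)(1 - P), while XP is built from the columns in S. Hence the
error is at most ‖X - XK‖_ν ‖1 - P‖₂. A nonzero idempotent satisfies ‖1 - P‖₂ ≤ ‖P‖₂ ≤ ‖P‖_Fr, and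
‖P‖_Fr² = tr K_S⁻¹.

The weight det K_S turns tr K_S⁻¹ into tr adj K_S = ∑_{i ∈ S} det K_{S∖i}. In the sum over S every T
of size k - 1 occurs d + 1 - k times, and the minors of size k - 1 of a rank-k projection add up to
k; this is the constant k(d + 1 - k). By Eckart–Young, XK is optimal of rank at most k in both norms
(`IsSVD.sub_truncation_le`). -/

section

open Matrix

/-! ### Principal minors -/

/-- The determinant of `1 + M` is the sum of all the principal minors of `M`. -/
theorem det_one_add_eq_sum_minors {n R : Type*} [Fintype n] [DecidableEq n] [CommRing R]
    (M : Matrix n n R) :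
    (1 + M).det = ∑ s : Finset n,
      (M.submatrix (Subtype.val : s → n) (Subtype.val : s → n)).det := by
  rw [add_comm]
  change detRowAlternating (fun i => M i + (1 : Matrix n n R) i) = _
  change (detRowAlternating : (n → R) [⋀^n]→ₗ[R] R)
    ((fun i => M i) + (fun i => (1 : Matrix n n R) i)) = _
  rw [AlternatingMap.map_add_univ]
  exact Finset.sum_congr rfl fun s _ => det_piecewise_one_eq_submatrix_det M s

/-- The principal minor of `K` with rows and columns in `S`. -/
noncomputable def principalMinor {n : Type*} (K : Matrix n n ℝ) (S : Finset n) : ℝ :=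
  by classical exact (K.submatrix (fun i : S => (i : n)) (fun i : S => (i : n))).det

theorem principalMinor_def {n : Type*} [DecidableEq n] (K : Matrix n n ℝ) (S : Finset n) :
    principalMinor K S = (K.submatrix (fun i : S => (i : n)) (fun i : S => (i : n))).det := by
  unfold principalMinor
  convert rfl

theorem principalMinor_diagonal_mul {n : Type*} [Fintype n] [DecidableEq n] (D : n → ℝ)
    (K : Matrix n n ℝ) (S : Finset n) :
    principalMinor (Matrix.diagonal D * K) S = (∏ i ∈ S, D i) * principalMinor K S := by
  rw [principalMinor_def, principalMinor_def, ← Finset.prod_coe_sort S D, ← Matrix.det_diagonal,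
    ← Matrix.det_mul]
  congr 1
  ext i j
  simp [Matrix.diagonal_mul]

/-- The sums of the principal minors of given size of `A * B` and of `B * A` coincide. -/
theorem sum_powersetCard_principalMinor_mul_comm {m n : Type*} [Fintype m] [DecidableEq m]
    [Fintype n] [DecidableEq n] (A : Matrix m n ℝ) (B : Matrix n m ℝ) (j : ℕ) :
    ∑ s ∈ Finset.univ.powersetCard j, principalMinor (A * B) s =
      ∑ s ∈ Finset.univ.powersetCard j, principalMinor (B * A) s := by
  simp only [principalMinor_def]
  -- Both sides are the coefficient of X^j in det(1 + X·AB) = det(1 + X·BA).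
  rw [← Matrix.coeff_det_one_add_X_smul_eq_sum_minors,
    ← Matrix.coeff_det_one_add_X_smul_eq_sum_minors, Matrix.map_mul, Matrix.map_mul,
    ← Matrix.smul_mul, Matrix.det_one_add_mul_comm, Matrix.mul_smul]

theorem principalMinor_one {n : Type*} [DecidableEq n] (s : Finset n) :
    principalMinor (1 : Matrix n n ℝ) s = 1 := by
  rw [principalMinor_def, Matrix.submatrix_one _ Subtype.val_injective, Matrix.det_one]

theorem principalMinor_univ {n : Type*} [Fintype n] [DecidableEq n] (K : Matrix n n ℝ) :
    principalMinor K Finset.univ = K.det := by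
  rw [principalMinor_def, ← Matrix.det_submatrix_equiv_self
    (Equiv.subtypeUnivEquiv (Finset.mem_univ (α := n))) K]
  rfl

/-! ### Projection determinantal point processes -/

variable {d k : ℕ}

/-- For a projection kernel of rank `k`, the principal minors of size `j` sum up to `k.choose j`. -/
theorem sum_principalMinor_projection {W : Matrix (Fin d) (Fin k) ℝ}
    (hW : W.transpose * W = 1) (j : ℕ) :
    ∑ s ∈ Finset.univ.powersetCard j, principalMinor (W * W.transpose) s = k.choose j := by
  rw [sum_powersetCard_principalMinor_mul_comm, hW]
  simp [principalMinor_one]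

/-- Cauchy–Binet for `Wᵀ D W` with `D` diagonal. -/
theorem det_transpose_mul_diagonal_mul (W : Matrix (Fin d) (Fin k) ℝ) (D : Fin d → ℝ) :
    (W.transpose * Matrix.diagonal D * W).det =
      ∑ s ∈ Finset.univ.powersetCard k, (∏ i ∈ s, D i) * principalMinor (W * W.transpose) s := by
  -- The terms are the minors of size k of D(W Wᵀ). Moved to the k × k product, they reduce to a
  -- single one, the determinant.
  simp_rw [← principalMinor_diagonal_mul]
  rw [← Matrix.mul_assoc, sum_powersetCard_principalMinor_mul_comm, ← Matrix.mul_assoc]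
  have : (Finset.univ : Finset (Fin k)).powersetCard k = {Finset.univ} := by
    ext s
    simp [← Finset.card_eq_iff_eq_univ]
  rw [this, Finset.sum_singleton, principalMinor_univ]

/-- The weight of `Y` under the projection determinantal point process of kernel `W Wᵀ`. -/
noncomputable def projectionWeight (W : Matrix (Fin d) (Fin k) ℝ) (Y : Finset (Fin d)) : ℝ :=
  if Y.card = k then principalMinor (W * W.transpose) Y else 0

theorem sum_projectionWeight_mul (W : Matrix (Fin d) (Fin k) ℝ) (f : Finset (Fin d) → ℝ) :
    ∑ Y, projectionWeight W Y * f Y =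
      ∑ Y ∈ Finset.univ.powersetCard k, principalMinor (W * W.transpose) Y * f Y := by
  rw [Finset.powersetCard_eq_filter, Finset.powerset_univ, Finset.sum_filter]
  simp only [projectionWeight, ite_mul, zero_mul]

/-- Cauchy–Binet with D the indicator of the complement of A kills every Y meeting A. Since WᵀW = 1,
the determinant is det(1 - Wᵀ 1_A W) = det(1 - 1_A W Wᵀ), which expands into principal minors. -/
theorem sum_filter_disjoint_projectionWeight {W : Matrix (Fin d) (Fin k) ℝ}
    (hW : W.transpose * W = 1) (A : Finset (Fin d)) :
    ∑ Y with Disjoint Y A, projectionWeight W Y =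
      ∑ S ∈ A.powerset, (-1) ^ S.card * principalMinor (W * W.transpose) S := by
  have h1 : ∑ Y with Disjoint Y A, projectionWeight W Y =
      (W.transpose * Matrix.diagonal (fun i => if i ∈ A then (0 : ℝ) else 1) * W).det := by
    rw [det_transpose_mul_diagonal_mul, Finset.sum_filter]
    have := sum_projectionWeight_mul W (fun Y => if Disjoint Y A then 1 else 0)
    simp only [mul_ite, mul_one, mul_zero] at this
    rw [this]
    refine Finset.sum_congr rfl fun Y _ => ?_
    split_ifs with h
    · rw [Finset.prod_congr rfl fun i hi => if_neg (Finset.disjoint_left.1 h hi)]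
      simp
    · obtain ⟨i, hi, hi'⟩ := Finset.not_disjoint_iff.1 h
      have h0 : ∏ i ∈ Y, (if i ∈ A then (0 : ℝ) else 1) = 0 :=
        Finset.prod_eq_zero hi (if_pos hi')
      rw [h0, zero_mul]
  have h2 : W.transpose * Matrix.diagonal (fun i => if i ∈ A then (0 : ℝ) else 1) * W =
      1 + W.transpose * (Matrix.diagonal (fun i => if i ∈ A then (-1 : ℝ) else 0) * W) := by
    rw [← hW, ← Matrix.mul_assoc, ← Matrix.add_mul]
    congr 1
    nth_rw 2 [← Matrix.mul_one W.transpose]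
    rw [← Matrix.mul_add, ← Matrix.diagonal_one, Matrix.diagonal_add]
    congr 2
    ext i
    split_ifs <;> simp
  rw [h1, h2, Matrix.det_one_add_mul_comm, det_one_add_eq_sum_minors, Matrix.mul_assoc]
  simp only [← principalMinor_def, principalMinor_diagonal_mul]
  rw [← Finset.filter_subset_univ, Finset.sum_filter]
  refine Finset.sum_congr rfl fun S _ => ?_
  split_ifs with h
  · rw [Finset.prod_congr rfl fun i hi => if_pos (h hi), Finset.prod_const]
  · obtain ⟨i, hi, hi'⟩ := Finset.not_subset.1 h
    rw [Finset.prod_eq_zero hi (if_neg hi'), zero_mul]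

theorem sum_filter_superset_projectionWeight {W : Matrix (Fin d) (Fin k) ℝ}
    (hW : W.transpose * W = 1) (S : Finset (Fin d)) :
    ∑ Y with S ⊆ Y, projectionWeight W Y = principalMinor (W * W.transpose) S := by
  -- Inclusion–exclusion: the alternating sum over subsets of Y ∩ A is 1 if Y misses A and 0
  -- otherwise.
  have key (A : Finset (Fin d)) :
      ∑ S ∈ A.powerset, (-1) ^ S.card * ∑ Y with S ⊆ Y, projectionWeight W Y =
        ∑ S ∈ A.powerset, (-1) ^ S.card * principalMinor (W * W.transpose) S := by
    rw [← sum_filter_disjoint_projectionWeight hW, Finset.sum_filter]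
    simp_rw [Finset.sum_filter, Finset.mul_sum]
    rw [Finset.sum_comm]
    refine Finset.sum_congr rfl fun Y _ => ?_
    have : ∑ S ∈ A.powerset, (-1 : ℝ) ^ S.card * (if S ⊆ Y then projectionWeight W Y else 0) =
        (∑ S ∈ (Y ∩ A).powerset, (-1 : ℝ) ^ S.card) * projectionWeight W Y := by
      simp_rw [mul_ite, mul_zero]
      rw [← Finset.sum_filter, Finset.sum_mul]
      refine Finset.sum_congr ?_ fun _ _ => rfl
      ext S
      simp only [Finset.mem_filter, Finset.mem_powerset, Finset.subset_inter_iff, and_comm]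
    rw [this]
    have h := congrArg (Int.cast : ℤ → ℝ) (Finset.sum_powerset_neg_one_pow_card (x := Y ∩ A))
    push_cast at h
    rw [h]
    simp [Finset.disjoint_iff_inter_eq_empty]
  -- In `key S` the terms of the proper subsets cancel by induction, which leaves the term of S.
  induction S using Finset.strongInduction with
  | H S ih =>
    have := key S
    have h2 : ∑ T ∈ S.powerset.erase S, (-1) ^ T.card * ∑ Y with T ⊆ Y, projectionWeight W Y =
        ∑ T ∈ S.powerset.erase S, (-1) ^ T.card * principalMinor (W * W.transpose) T :=
      Finset.sum_congr rfl fun T hT => by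
        rw [Finset.mem_erase, Finset.mem_powerset] at hT
        rw [ih T (hT.2.ssubset_of_ne hT.1)]
    rw [← Finset.insert_erase (Finset.mem_powerset_self S),
      Finset.sum_insert (Finset.notMem_erase _ _), Finset.sum_insert (Finset.notMem_erase _ _),
      h2, add_left_inj] at this
    exact mul_left_cancel₀ (pow_ne_zero _ (by norm_num)) this

/-- Möbius inversion on the lattice of subsets; this gives the uniqueness of the law. -/
theorem eq_of_sum_superset_eq {f g : Finset (Fin d) → ℝ}
    (h : ∀ S, ∑ Y with S ⊆ Y, f Y = ∑ Y with S ⊆ Y, g Y) : f = g := by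
  ext S
  rw [IncidenceAlgebra.moebius_inversion_top f _ (fun _ => rfl),
    IncidenceAlgebra.moebius_inversion_top g _ (fun _ => rfl)]
  have hI (S : Finset (Fin d)) : Finset.Ici S = Finset.univ.filter (S ⊆ ·) := by
    ext Y
    simp
  simp_rw [hI, h]

theorem sq_det_rowSubmatrix (W : Matrix (Fin d) (Fin k) ℝ) (S : Finset (Fin d))
    (hS : S.card = k) :
    (rowSubmatrix W S hS).det ^ 2 = principalMinor (W * W.transpose) S := by
  rw [principalMinor_def, ← Matrix.det_submatrix_equiv_self (S.orderIsoOfFin hS).toEquiv, sq]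
  nth_rw 2 [← Matrix.det_transpose]
  rw [← Matrix.det_mul]
  rfl

/-! ### The sum of the adjugate traces -/

/-- The trace of the adjugate of a principal submatrix is a sum of principal minors. -/
theorem trace_adjugate_submatrix (K : Matrix (Fin d) (Fin d) ℝ) (S : Finset (Fin d)) :
    (K.submatrix (fun i : S => (i : Fin d)) (fun i : S => (i : Fin d))).adjugate.trace =
      ∑ i ∈ S, principalMinor K (S.erase i) := by
  rw [← Finset.sum_coe_sort S (fun i => principalMinor K (S.erase i))]
  refine Finset.sum_congr rfl fun i _ => ?_
  rw [Matrix.diag_apply, Matrix.adjugate_apply]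
  set A := K.submatrix (fun i : S => (i : Fin d)) (fun i : S => (i : Fin d)) with hA
  -- The diagonal adjugate entry replaces row i by a unit vector, that is, by row i of the identity;
  -- the determinant is then the minor without i.
  have h1 : A.updateRow i (Pi.single i 1) =
      Matrix.of ((Finset.univ.erase i).piecewise A.row (1 : Matrix S S ℝ).row) := by
    ext a b
    by_cases h : a = i
    · subst h
      rw [Matrix.updateRow_self, Matrix.of_apply,
        Finset.piecewise_eq_of_notMem _ _ _ (Finset.notMem_erase _ _), Matrix.row_apply,
        Matrix.one_apply, Pi.single_apply]
      simp only [eq_comm]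
    · rw [Matrix.updateRow_ne h, Matrix.of_apply, Finset.piecewise_eq_of_mem _ _ _
        (Finset.mem_erase.2 ⟨h, Finset.mem_univ _⟩), Matrix.row_apply]
  rw [h1, Matrix.det_piecewise_one_eq_submatrix_det, principalMinor_def]
  let e : (S.erase (i : Fin d) : Finset (Fin d)) ≃ ((Finset.univ : Finset S).erase i : Finset S) :=
    { toFun := fun a => ⟨⟨a, Finset.mem_of_mem_erase a.2⟩, by
        have := Finset.ne_of_mem_erase a.2
        exact Finset.mem_erase.2 ⟨fun h => this (congrArg Subtype.val h), Finset.mem_univ _⟩⟩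
      invFun := fun a => ⟨a.1, Finset.mem_erase.2 
        ⟨fun h => Finset.ne_of_mem_erase a.2 (Subtype.ext h), a.1.2⟩⟩
      left_inv := fun a => rfl
      right_inv := fun a => rfl }
  rw [← Matrix.det_submatrix_equiv_self e]
  rfl

/-- Double counting: (S, i) with i ∈ S corresponds to (S∖i, i), and each T of size m has d - m
elements outside it. -/
theorem sum_sum_erase (f : Finset (Fin d) → ℝ) (m : ℕ) :
    ∑ S ∈ Finset.univ.powersetCard (m + 1), ∑ i ∈ S, f (S.erase i) =
      ((d : ℝ) - m) * ∑ T ∈ Finset.univ.powersetCard m, f T := by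
  have h : ∀ T ∈ (Finset.univ : Finset (Fin d)).powersetCard m,
      ((d : ℝ) - m) * f T = ∑ i ∈ Tᶜ, f T := by
    intro T hT
    have hc := (Finset.mem_powersetCard.1 hT).2
    have := Finset.card_add_card_compl T
    rw [Fintype.card_fin, hc] at this
    have h' : (m : ℝ) + Tᶜ.card = d := by exact_mod_cast this
    rw [Finset.sum_const, nsmul_eq_mul, ← h']
    ring
  rw [Finset.mul_sum, Finset.sum_congr rfl h, Finset.sum_sigma', Finset.sum_sigma']
  refine Finset.sum_bij' (fun (x : (_ : Finset (Fin d)) × Fin d) _ => ⟨x.1.erase x.2, x.2⟩)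
    (fun (x : (_ : Finset (Fin d)) × Fin d) _ => ⟨insert x.2 x.1, x.2⟩) ?_ ?_ ?_ ?_ ?_ <;>
    rintro ⟨S, i⟩ h <;>
    simp only [Finset.mem_sigma, Finset.mem_powersetCard, Finset.mem_compl] at h ⊢
  · simp [Finset.card_erase_of_mem h.2, h.1.2]
  · simp [Finset.card_insert_of_notMem h.2, h.1.2]
  · simp [Finset.insert_erase h.2]
  · simp [Finset.erase_insert h.2]

theorem sum_trace_adjugate_projection {W : Matrix (Fin d) (Fin k) ℝ}
    (hW : W.transpose * W = 1) (hk : 1 ≤ k) :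
    ∑ S ∈ Finset.univ.powersetCard k, ((W * W.transpose).submatrix
      (fun i : (S : Finset (Fin d)) => (i : Fin d)) (fun i : S => (i : Fin d))).adjugate.trace =
      (k : ℝ) * ((d : ℝ) + 1 - k) := by
  obtain ⟨m, rfl⟩ : ∃ m, k = m + 1 := ⟨k - 1, by omega⟩
  simp_rw [trace_adjugate_submatrix]
  rw [sum_sum_erase, sum_principalMinor_projection hW]
  rw [Nat.choose_succ_self_right]
  push_cast
  ring

/-! ### Spectral and Frobenius norm inequalities -/

theorem matNorm_nonneg {m n : ℕ} (ν : NormKind) (A : Matrix (Fin m) (Fin n) ℝ) :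
    0 ≤ matNorm ν A := by
  cases ν
  · exact @norm_nonneg _
      Matrix.instL2OpNormedAddCommGroup.toSeminormedAddCommGroup.toSeminormedAddGroup A
  · exact @norm_nonneg _
      Matrix.frobeniusNormedAddCommGroup.toSeminormedAddCommGroup.toSeminormedAddGroup A

theorem frobenius_sq {m n : ℕ} (A : Matrix (Fin m) (Fin n) ℝ) :
    matNorm .frobenius A ^ 2 = (A.transpose * A).trace := by
  have h := @Matrix.frobenius_norm_def (Fin m) (Fin n) ℝ _ _ _ A
  change @norm _ Matrix.frobeniusNormedAddCommGroup.toNorm A ^ 2 = _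
  erw [h]
  rw [← Real.sqrt_eq_rpow, Real.sq_sqrt (by positivity), Finset.sum_comm]
  simp [Matrix.trace, Matrix.mul_apply, ← sq]

theorem trace_transpose_mul_self_eq_sum {m n : Type*} [Fintype m] [Fintype n]
    (A : Matrix m n ℝ) : (Aᵀ * A).trace = ∑ j, (A.col j ⬝ᵥ A.col j) := by
  simp [Matrix.trace, Matrix.mul_apply, dotProduct]

theorem trace_transpose_mul_self_nonneg {m n : Type*} [Fintype m] [Fintype n]
    (A : Matrix m n ℝ) : 0 ≤ (Aᵀ * A).trace := by
  rw [trace_transpose_mul_self_eq_sum]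
  exact Finset.sum_nonneg fun j _ => Finset.sum_nonneg fun i _ => mul_self_nonneg _

theorem norm_toLp_sq {n : Type*} [Fintype n] (v : n → ℝ) :
    ‖WithLp.toLp 2 v‖ ^ 2 = v ⬝ᵥ v := by
  rw [EuclideanSpace.real_norm_sq_eq]
  simp [dotProduct, sq]

theorem mulVec_dotProduct_le {m n : ℕ} (A : Matrix (Fin m) (Fin n) ℝ) (v : Fin n → ℝ) :
    (A *ᵥ v) ⬝ᵥ (A *ᵥ v) ≤ matNorm .spectral A ^ 2 * (v ⬝ᵥ v) := by
  rw [← norm_toLp_sq, ← norm_toLp_sq, ← mul_pow]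
  exact pow_le_pow_left₀ (norm_nonneg _) (Matrix.l2_opNorm_mulVec A (WithLp.toLp 2 v)) 2

theorem spectral_sq_le {m n : ℕ} (A : Matrix (Fin m) (Fin n) ℝ) {c : ℝ} (hc : 0 ≤ c)
    (h : ∀ v, (A *ᵥ v) ⬝ᵥ (A *ᵥ v) ≤ c * (v ⬝ᵥ v)) : matNorm .spectral A ^ 2 ≤ c := by
  rw [← Real.le_sqrt (matNorm_nonneg _ _) hc]
  refine ContinuousLinearMap.opNorm_le_bound
    (((toEuclideanLin (𝕜 := ℝ) (m := Fin m) (n := Fin n)).trans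
      LinearMap.toContinuousLinearMap) A) (Real.sqrt_nonneg _) fun x => ?_
  refine (sq_le_sq₀ (norm_nonneg _) (by positivity)).1 ?_
  rw [mul_pow, Real.sq_sqrt hc]
  have := h x.ofLp
  rwa [← norm_toLp_sq, ← norm_toLp_sq] at this

theorem frobenius_sq_mul_le {m n l : ℕ} (A : Matrix (Fin m) (Fin n) ℝ)
    (B : Matrix (Fin n) (Fin l) ℝ) :
    matNorm .frobenius (A * B) ^ 2 ≤ matNorm .spectral A ^ 2 * matNorm .frobenius B ^ 2 := by
  rw [frobenius_sq, frobenius_sq, trace_transpose_mul_self_eq_sum, trace_transpose_mul_self_eq_sum,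
    Finset.mul_sum]
  exact Finset.sum_le_sum fun j _ => mulVec_dotProduct_le A (B.col j)

theorem frobenius_transpose {m n : ℕ} (A : Matrix (Fin m) (Fin n) ℝ) :
    matNorm .frobenius Aᵀ = matNorm .frobenius A :=
  Matrix.frobenius_norm_transpose A

theorem spectral_transpose {m n : ℕ} (A : Matrix (Fin m) (Fin n) ℝ) :
    matNorm .spectral Aᵀ = matNorm .spectral A := by
  rw [← Matrix.conjTranspose_eq_transpose_of_trivial]
  exact Matrix.l2_opNorm_conjTranspose A

theorem spectral_sq_le_frobenius_sq {m n : ℕ} (A : Matrix (Fin m) (Fin n) ℝ) :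
    matNorm .spectral A ^ 2 ≤ matNorm .frobenius A ^ 2 := by
  refine spectral_sq_le A (sq_nonneg _) fun v => ?_
  rw [← frobenius_transpose, frobenius_sq, trace_transpose_mul_self_eq_sum, Finset.sum_mul]
  refine Finset.sum_le_sum fun i _ => ?_
  have := Finset.sum_mul_sq_le_sq_mul_sq Finset.univ (A i) v
  simpa [Matrix.mulVec, dotProduct, ← sq] using this

/-- Both norms satisfy `‖A B‖_ν ≤ ‖A‖_ν ‖B‖₂`. -/
theorem matNorm_sq_mul_le {m n l : ℕ} (ν : NormKind) (A : Matrix (Fin m) (Fin n) ℝ)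
    (B : Matrix (Fin n) (Fin l) ℝ) :
    matNorm ν (A * B) ^ 2 ≤ matNorm ν A ^ 2 * matNorm .spectral B ^ 2 := by
  cases ν
  · rw [← mul_pow]
    exact pow_le_pow_left₀ (matNorm_nonneg _ _) (Matrix.l2_opNorm_mul A B) 2
  · rw [← frobenius_transpose, transpose_mul, ← frobenius_transpose A, ← spectral_transpose B,
      mul_comm]
    exact frobenius_sq_mul_le _ _

/-- The complement of a nonzero idempotent has at most the same norm. -/
theorem norm_sub_apply_le_of_isIdempotent {E : Type*} [NormedAddCommGroup E]
    [InnerProductSpace ℝ E] (P : E →ₗ[ℝ] E) (hP : ∀ x, P (P x) = P x) {w : E} (hw : w ≠ 0)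
    (hPw : P w = w) {c : ℝ} (hc : ∀ x, ‖P x‖ ≤ c * ‖x‖) (x : E) : ‖x - P x‖ ≤ c * ‖x‖ := by
  -- The nonzero fixed vector w forces c ≥ 1, which settles the case P x = 0.
  have hc1 : 1 ≤ c := by
    have := hc w
    rw [hPw] at this
    exact le_of_mul_le_mul_right (by simpa using this) (norm_pos_iff.2 hw)
  set u := P x with hu
  set v := x - P x with hv
  have hx : x = u + v := (add_sub_cancel u x).symm
  by_cases h0 : u = 0
  · rw [h0, zero_add] at hx
    rw [hx]
    exact le_mul_of_one_le_left (norm_nonneg _) hc1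
  by_cases h1 : v = 0
  · rw [h1, norm_zero]
    positivity
  have hPv : P v = 0 := by rw [hv, map_sub, hP, sub_self]
  have hPu : P u = u := hP x
  have hu' := norm_pos_iff.2 h0
  have hv' := norm_pos_iff.2 h1
  -- Exchanging the lengths of u and v preserves the norm of the sum, since the two factors have
  -- product 1 in the cross term. The projection P sends the new vector to one of length ‖v‖.
  have hn : ‖(‖v‖ / ‖u‖) • u + (‖u‖ / ‖v‖) • v‖ = ‖u + v‖ := by
    rw [← sq_eq_sq₀ (norm_nonneg _) (norm_nonneg _), norm_add_sq_real, norm_add_sq_real,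
      norm_smul, norm_smul, inner_smul_left, inner_smul_right, Real.norm_of_nonneg (by positivity),
      Real.norm_of_nonneg (by positivity)]
    simp only [conj_trivial]
    field_simp
    ring
  have := hc ((‖v‖ / ‖u‖) • u + (‖u‖ / ‖v‖) • v)
  rw [map_add, map_smul, map_smul, hPv, hPu, smul_zero, add_zero, hn, ← hx, norm_smul,
    Real.norm_of_nonneg (by positivity), div_mul_cancel₀ _ hu'.ne'] at this
  exact this

theorem spectral_sq_one_sub_le {n : ℕ} {P : Matrix (Fin n) (Fin n) ℝ} (hP : P * P = P)
    (h0 : P ≠ 0) : matNorm .spectral (1 - P) ^ 2 ≤ matNorm .spectral P ^ 2 := by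
  refine spectral_sq_le _ (sq_nonneg _) fun v => ?_
  obtain ⟨z, hz⟩ : ∃ z, P *ᵥ z ≠ 0 := by
    by_contra! h
    exact h0 (Matrix.ext_of_mulVec_single fun i => by rw [h, zero_mulVec])
  have := norm_sub_apply_le_of_isIdempotent (toEuclideanLin P) (w := WithLp.toLp 2 (P *ᵥ z))
    (c := matNorm .spectral P) (fun x => ?_) ?_ ?_ (fun x => Matrix.l2_opNorm_mulVec P x)
    (WithLp.toLp 2 v)
  · rw [← norm_toLp_sq, ← norm_toLp_sq, ← mul_pow, sub_mulVec, one_mulVec]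
    exact pow_le_pow_left₀ (norm_nonneg _) this 2
  · rw [toLpLin_apply, toLpLin_apply]
    simp [mulVec_mulVec, hP]
  · simpa using hz
  · rw [toLpLin_apply]
    simp [mulVec_mulVec, hP]

theorem mulVec_dotProduct_mulVec_of_orthonormal {m n : Type*} [Fintype m] [Fintype n]
    [DecidableEq n] {V : Matrix m n ℝ} (hV : Vᵀ * V = 1) (x y : n → ℝ) :
    (V *ᵥ x) ⬝ᵥ (V *ᵥ y) = x ⬝ᵥ y := by
  rw [dotProduct_mulVec, ← mulVec_transpose, mulVec_mulVec, hV, one_mulVec]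

/-- Bessel's inequality: expand the square of the residual v - V Vᵀ v. -/
theorem transpose_mulVec_dotProduct_le {m n : Type*} [Fintype m] [Fintype n]
    [DecidableEq n] {V : Matrix m n ℝ} (hV : Vᵀ * V = 1) (v : m → ℝ) :
    (Vᵀ *ᵥ v) ⬝ᵥ (Vᵀ *ᵥ v) ≤ v ⬝ᵥ v := by
  have h : 0 ≤ (v - V *ᵥ (Vᵀ *ᵥ v)) ⬝ᵥ (v - V *ᵥ (Vᵀ *ᵥ v)) :=
    Finset.sum_nonneg fun i _ => mul_self_nonneg _
  rw [sub_dotProduct, dotProduct_sub, dotProduct_sub, mulVec_dotProduct_mulVec_of_orthonormal hV,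
    dotProduct_comm (V *ᵥ _) v, dotProduct_mulVec v V, ← mulVec_transpose] at h
  linarith

theorem trace_transpose_mul_le {m n l : Type*} [Fintype m] [Fintype n] [Fintype l]
    [DecidableEq n] {V : Matrix m n ℝ} (hV : Vᵀ * V = 1) (B : Matrix m l ℝ) :
    ((Vᵀ * B)ᵀ * (Vᵀ * B)).trace ≤ (Bᵀ * B).trace := by
  rw [trace_transpose_mul_self_eq_sum, trace_transpose_mul_self_eq_sum]
  exact Finset.sum_le_sum fun j _ => transpose_mulVec_dotProduct_le hV (B.col j)

/-! ### Truncated singular value decomposition and Eckart–Young -/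

theorem firstCols_orthonormal {d r k : ℕ} (hkr : k ≤ r) {V : Matrix (Fin d) (Fin r) ℝ}
    (hV : Vᵀ * V = 1) : (firstCols hkr V)ᵀ * firstCols hkr V = 1 := by
  have : (firstCols hkr V)ᵀ * firstCols hkr V =
      (Vᵀ * V).submatrix (Fin.castLE hkr) (Fin.castLE hkr) := rfl
  rw [this, hV, submatrix_one _ (Fin.castLE_injective hkr)]

theorem firstCols_mul_transpose {d r k : ℕ} (hkr : k ≤ r) (V : Matrix (Fin d) (Fin r) ℝ) :
    firstCols hkr V * (firstCols hkr V)ᵀ =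
      V * diagonal (fun i : Fin r => if (i : ℕ) < k then (1 : ℝ) else 0) * Vᵀ := by
  obtain ⟨m, rfl⟩ := Nat.exists_eq_add_of_le hkr
  ext i j
  rw [mul_apply, mul_apply, Fin.sum_univ_add]
  simp [mul_diagonal, firstCols, Fin.castLE, Fin.castAdd]

section EckartYoung

variable {N d r k : ℕ} {X : Matrix (Fin N) (Fin d) ℝ} {U : Matrix (Fin N) (Fin r) ℝ}
  {σ : Fin r → ℝ} {V : Matrix (Fin d) (Fin r) ℝ}

/-- The residual of the truncated singular value decomposition. -/
theorem IsSVD.sub_truncation (h : IsSVD X U σ V) (hkr : k ≤ r) :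
    X - X * (firstCols hkr V * (firstCols hkr V)ᵀ) =
      U * diagonal (fun i : Fin r => if (i : ℕ) < k then 0 else σ i) * Vᵀ := by
  have h1 : X * (firstCols hkr V * (firstCols hkr V)ᵀ) =
      U * diagonal (fun i : Fin r => if (i : ℕ) < k then σ i else 0) * Vᵀ := by
    rw [firstCols_mul_transpose, h.eq]
    calc _ = U * (diagonal σ * (Vᵀ * V) *
          diagonal (fun i : Fin r => if (i : ℕ) < k then (1 : ℝ) else 0)) * Vᵀ := by
            simp only [Matrix.mul_assoc]
      _ = _ := by rw [h.orthonormal_right, Matrix.mul_one, diagonal_mul_diagonal]; simp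
  rw [h1, h.eq, ← Matrix.sub_mul, ← Matrix.mul_sub, diagonal_sub]
  congr 3
  ext i
  split_ifs <;> simp

theorem mulVec_diagonal_dotProduct (hU : Uᵀ * U = 1) (τ z : Fin r → ℝ) :
    ((U * diagonal τ) *ᵥ z) ⬝ᵥ ((U * diagonal τ) *ᵥ z) = ∑ i, τ i ^ 2 * z i ^ 2 := by
  rw [← mulVec_mulVec, mulVec_dotProduct_mulVec_of_orthonormal hU]
  exact Finset.sum_congr rfl fun i _ => by rw [mulVec_diagonal]; ring

theorem spectral_sq_mul_diagonal_mul_le (hU : Uᵀ * U = 1) (hV : Vᵀ * V = 1) {τ : Fin r → ℝ}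
    {c : ℝ} (hc : 0 ≤ c) (hτ : ∀ i, τ i ^ 2 ≤ c) :
    matNorm .spectral (U * diagonal τ * Vᵀ) ^ 2 ≤ c := by
  refine spectral_sq_le _ hc fun v => ?_
  rw [← mulVec_mulVec, mulVec_diagonal_dotProduct hU]
  refine le_trans ?_ (mul_le_mul_of_nonneg_left (transpose_mulVec_dotProduct_le hV v) hc)
  rw [dotProduct, Finset.mul_sum]
  exact Finset.sum_le_sum fun i _ => by
    rw [← sq]
    exact mul_le_mul_of_nonneg_right (hτ i) (sq_nonneg _)

theorem exists_mulVec_eq_zero_of_rank_lt {m n : ℕ} (A : Matrix (Fin m) (Fin n) ℝ)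
    (h : A.rank < n) : ∃ c ≠ 0, A *ᵥ c = 0 := by
  have h1 : LinearMap.ker A.mulVecLin ≠ ⊥ := by
    intro h0
    have := LinearMap.finrank_range_add_finrank_ker A.mulVecLin
    rw [h0, finrank_bot, add_zero, Module.finrank_fin_fun] at this
    exact h.ne this
  obtain ⟨c, hc, hc0⟩ := Submodule.exists_mem_ne_zero_of_ne_bot h1
  exact ⟨c, hc0, hc⟩

/-- Since A has rank at most k, it kills a nonzero vector in the span of the first k + 1 right
singular vectors. There X - A acts as X, which stretches by at least the last of these singular
values, hence by at least σ i. -/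
theorem IsSVD.sq_le_spectral_sq_sub (h : IsSVD X U σ V) {A : Matrix (Fin N) (Fin d) ℝ}
    (hA : A.rank ≤ k) {i : Fin r} (hi : k ≤ i) :
    σ i ^ 2 ≤ matNorm .spectral (X - A) ^ 2 := by
  have hkr : k + 1 ≤ r := by omega
  set J := firstCols hkr (1 : Matrix (Fin r) (Fin r) ℝ) with hJ
  have hJJ : Jᵀ * J = 1 := firstCols_orthonormal hkr (by simp)
  obtain ⟨c, hc0, hc⟩ := exists_mulVec_eq_zero_of_rank_lt (A * (V * J))
    ((rank_mul_le_left _ _).trans_lt (Nat.lt_succ_of_le hA))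
  have hz (j : Fin r) (hj : k < j) : (J *ᵥ c) j = 0 := by
    change ∑ a, J j a * c a = 0
    refine Finset.sum_eq_zero fun a _ => ?_
    have : j ≠ Fin.castLE hkr a := by
      intro h
      have := congrArg Fin.val h
      simp at this
      omega
    have h0 : J j a = 0 := one_apply_ne this
    rw [h0, zero_mul]
  have h1 := mulVec_dotProduct_le (X - A) (V *ᵥ (J *ᵥ c))
  have h2 : (X - A) *ᵥ (V *ᵥ (J *ᵥ c)) = (U * diagonal σ) *ᵥ (J *ᵥ c) := by
    rw [sub_mulVec, mulVec_mulVec c, mulVec_mulVec _ A, hc, sub_zero, h.eq, mulVec_mulVec,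
      Matrix.mul_assoc, ← Matrix.mul_assoc Vᵀ, h.orthonormal_right, Matrix.one_mul, mulVec_mulVec]
  have hpos : 0 < c ⬝ᵥ c := by
    refine lt_of_le_of_ne (Finset.sum_nonneg fun i _ => mul_self_nonneg _) fun h => hc0 ?_
    exact dotProduct_self_eq_zero.1 h.symm
  rw [h2, mulVec_diagonal_dotProduct h.orthonormal_left,
    mulVec_dotProduct_mulVec_of_orthonormal h.orthonormal_right] at h1
  refine le_of_mul_le_mul_right (le_trans ?_ (h1.trans_eq ?_)) hpos
  · rw [← mulVec_dotProduct_mulVec_of_orthonormal hJJ, dotProduct, Finset.mul_sum]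
    refine Finset.sum_le_sum fun j _ => ?_
    by_cases hj : k < j
    · simp [hz j hj]
    · rw [← sq]
      exact mul_le_mul_of_nonneg_right
        (pow_le_pow_left₀ (h.pos i).le (h.antitone (Fin.le_def.2 (by omega))) 2) (sq_nonneg _)
  · rw [mulVec_dotProduct_mulVec_of_orthonormal hJJ]

/-- A matrix of rank at most `k` is fixed by the projection onto the span of at most `k`
orthonormal vectors. -/
theorem exists_orthonormal_mul_eq {A : Matrix (Fin N) (Fin d) ℝ} (hA : A.rank ≤ k) :
    ∃ (m : ℕ) (E : Matrix (Fin N) (Fin m) ℝ), m ≤ k ∧ Eᵀ * E = 1 ∧ E * (Eᵀ * A) = A := by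
  set S := LinearMap.range (toEuclideanLin A) with hS
  obtain ⟨b⟩ : Nonempty (OrthonormalBasis (Fin (Module.finrank ℝ S)) ℝ S) :=
    ⟨stdOrthonormalBasis ℝ S⟩
  let E : Matrix (Fin N) (Fin (Module.finrank ℝ S)) ℝ :=
    Matrix.of fun i j => (b j : EuclideanSpace ℝ (Fin N)) i
  refine ⟨_, E, ?_, ?_, ?_⟩
  · rw [Matrix.rank_eq_finrank_range_toLin A (EuclideanSpace.basisFun _ ℝ).toBasis
      (EuclideanSpace.basisFun _ ℝ).toBasis] at hA
    exact hA
  · ext i j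
    have := orthonormal_iff_ite.1 b.orthonormal i j
    rw [one_apply, ← this, mul_apply, Submodule.coe_inner, PiLp.inner_apply]
    exact Finset.sum_congr rfl fun a _ => mul_comm _ _
  · refine Matrix.ext_of_mulVec_single fun j => ?_
    have hy : WithLp.toLp 2 (A *ᵥ Pi.single j 1) ∈ S := ⟨WithLp.toLp 2 (Pi.single j 1), rfl⟩
    rw [← mulVec_mulVec, ← mulVec_mulVec]
    generalize A *ᵥ Pi.single j 1 = y at hy
    have := congrArg (fun x : S => (x : EuclideanSpace ℝ (Fin N)).ofLp) (b.sum_repr' ⟨_, hy⟩)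
    refine Eq.trans ?_ this
    ext i
    simp only [mulVec, dotProduct]
    simp [E, PiLp.inner_apply, mul_comm]

theorem frobenius_sq_mul_diagonal_mul (hU : Uᵀ * U = 1) (hV : Vᵀ * V = 1) (τ : Fin r → ℝ) :
    matNorm .frobenius (U * diagonal τ * Vᵀ) ^ 2 = ∑ i, τ i ^ 2 := by
  rw [frobenius_sq]
  have : (U * diagonal τ * Vᵀ)ᵀ * (U * diagonal τ * Vᵀ) =
      V * (diagonal τ * (Uᵀ * U) * diagonal τ * Vᵀ) := by
    simp [transpose_mul, Matrix.mul_assoc]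
  rw [this, trace_mul_comm, hU, Matrix.mul_one, Matrix.mul_assoc, hV, Matrix.mul_one,
    diagonal_mul_diagonal, trace_diagonal]
  simp [sq]

/-- Projecting off an orthonormal family E of at most k vectors whose span contains the columns of A
kills A, so ‖X - A‖² ≥ ‖X - E Eᵀ X‖² = ∑ σ_i² (1 - t_i) with t_i = ‖Eᵀ u_i‖². As 0 ≤ t_i ≤ 1 and ∑
t_i ≤ k, the sum is least when the mass sits on the k largest σ_i. -/
theorem IsSVD.sum_tail_le_frobenius_sq_sub (h : IsSVD X U σ V) (hk : 1 ≤ k) (hkr : k ≤ r)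
    {A : Matrix (Fin N) (Fin d) ℝ} (hA : A.rank ≤ k) :
    ∑ i : Fin r, (if (i : ℕ) < k then 0 else σ i) ^ 2 ≤ matNorm .frobenius (X - A) ^ 2 := by
  obtain ⟨m, E, hm, hE, hEA⟩ := exists_orthonormal_mul_eq hA
  have pyth (Y : Matrix (Fin N) (Fin d) ℝ) : ((Y - E * (Eᵀ * Y))ᵀ * (Y - E * (Eᵀ * Y))).trace =
      (Yᵀ * Y).trace - ((Eᵀ * Y)ᵀ * (Eᵀ * Y)).trace := by
    rw [← trace_sub]
    congr 1
    have e1 : (E * (Eᵀ * Y))ᵀ * (E * (Eᵀ * Y)) = (Eᵀ * Y)ᵀ * (Eᵀ * Y) := by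
      rw [transpose_mul, Matrix.mul_assoc, ← Matrix.mul_assoc Eᵀ E, hE, Matrix.one_mul]
    have e2 : (E * (Eᵀ * Y))ᵀ * Y = (Eᵀ * Y)ᵀ * (Eᵀ * Y) := by
      rw [transpose_mul, Matrix.mul_assoc]
    have e3 : Yᵀ * (E * (Eᵀ * Y)) = (Eᵀ * Y)ᵀ * (Eᵀ * Y) := by
      simp [transpose_mul, Matrix.mul_assoc]
    rw [transpose_sub, Matrix.sub_mul, Matrix.mul_sub, Matrix.mul_sub, e1, e2, e3]
    abel
  set M := Eᵀ * U with hM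
  set t : Fin r → ℝ := fun i => (Mᵀ * M) i i with ht
  have ht0 (i) : 0 ≤ t i := by
    change 0 ≤ M.col i ⬝ᵥ M.col i
    exact Finset.sum_nonneg fun j _ => mul_self_nonneg _
  have ht1 (i) : t i ≤ 1 := by
    have := transpose_mulVec_dotProduct_le hE (U.col i)
    have hu : U.col i ⬝ᵥ U.col i = 1 :=
      (congrFun (congrFun h.orthonormal_left i) i).trans (one_apply_eq i)
    rw [hu] at this
    exact this
  have hts : ∑ i, t i ≤ k := by
    have h1 : ∑ i, t i = ((Uᵀ * E)ᵀ * (Uᵀ * E)).trace := by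
      change (Mᵀ * M).trace = _
      rw [trace_mul_comm, hM]
      simp [transpose_mul]
    have h2 := trace_transpose_mul_le h.orthonormal_left E
    rw [hE, trace_one, Fintype.card_fin, ← h1] at h2
    exact h2.trans (by exact_mod_cast hm)
  have h1 : ∑ i, σ i ^ 2 * (1 - t i) ≤ matNorm .frobenius (X - A) ^ 2 := by
    have e1 := trace_transpose_mul_self_nonneg (Eᵀ * (X - A))
    have e2 := pyth (X - A)
    have e3 := pyth X
    have e4 : X - A - E * (Eᵀ * (X - A)) = X - E * (Eᵀ * X) := by
      rw [Matrix.mul_sub, Matrix.mul_sub, hEA]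
      abel
    have e5 : (Xᵀ * X).trace = ∑ i, σ i ^ 2 := by
      rw [← frobenius_sq, h.eq, frobenius_sq_mul_diagonal_mul h.orthonormal_left h.orthonormal_right]
    have e6 : ((Eᵀ * X)ᵀ * (Eᵀ * X)).trace = ∑ i, σ i ^ 2 * t i := by
      have : (Eᵀ * X)ᵀ * (Eᵀ * X) = V * (diagonal σ * (Mᵀ * M) * diagonal σ * Vᵀ) := by
        rw [hM, h.eq]
        simp [transpose_mul, Matrix.mul_assoc]
      rw [this, trace_mul_comm, Matrix.mul_assoc, h.orthonormal_right, Matrix.mul_one]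
      refine Finset.sum_congr rfl fun i _ => ?_
      rw [diag_apply, mul_diagonal, diagonal_mul]
      ring
    rw [frobenius_sq]
    rw [e4] at e2
    simp only [mul_sub, mul_one, Finset.sum_sub_distrib]
    linarith
  refine le_trans ?_ h1
  -- The k-th singular value squared serves as threshold: σ_i² ≥ s for i < k and σ_i² ≤ s
  -- afterwards. The termwise bounds below then sum to s(k - ∑ t_i) ≥ 0.
  set s := σ ⟨k - 1, by omega⟩ ^ 2 with hs
  have hcount : ∑ i : Fin r, (if (i : ℕ) < k then (1 : ℝ) else 0) = k := by
    obtain ⟨m, rfl⟩ := Nat.exists_eq_add_of_le hkr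
    rw [Fin.sum_univ_add]
    simp
  have h2 : ∑ i : Fin r, s * ((if (i : ℕ) < k then (1 : ℝ) else 0) - t i) ≤
      ∑ i : Fin r, (σ i ^ 2 * (1 - t i) - (if (i : ℕ) < k then 0 else σ i) ^ 2) := by
    refine Finset.sum_le_sum fun i _ => ?_
    split_ifs with hi
    · have : s ≤ σ i ^ 2 :=
        pow_le_pow_left₀ (h.pos _).le (h.antitone (Fin.le_def.2 (by simp; omega))) 2
      nlinarith [mul_nonneg (sub_nonneg.2 this) (sub_nonneg.2 (ht1 i))]
    · have : σ i ^ 2 ≤ s :=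
        pow_le_pow_left₀ (h.pos _).le (h.antitone (Fin.le_def.2 (by simp; omega))) 2
      nlinarith [mul_nonneg (sub_nonneg.2 this) (ht0 i)]
  rw [← Finset.mul_sum, Finset.sum_sub_distrib, Finset.sum_sub_distrib, hcount] at h2
  have := mul_nonneg (sq_nonneg (σ ⟨k - 1, by omega⟩)) (sub_nonneg.2 hts)
  linarith

/-- The Eckart–Young–Mirsky theorem, for both norms. -/
theorem IsSVD.sub_truncation_le (h : IsSVD X U σ V) (hk : 1 ≤ k) (hkr : k ≤ r) (ν : NormKind)
    {A : Matrix (Fin N) (Fin d) ℝ} (hA : A.rank ≤ k) :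
    matNorm ν (X - X * (firstCols hkr V * (firstCols hkr V)ᵀ)) ^ 2 ≤ matNorm ν (X - A) ^ 2 := by
  rw [h.sub_truncation]
  cases ν
  · refine spectral_sq_mul_diagonal_mul_le h.orthonormal_left h.orthonormal_right (sq_nonneg _)
      fun i => ?_
    split_ifs with hi
    · rw [sq, zero_mul]
      exact sq_nonneg _
    · exact h.sq_le_spectral_sq_sub hA (not_lt.1 hi)
  · rw [frobenius_sq_mul_diagonal_mul h.orthonormal_left h.orthonormal_right]
    exact h.sum_tail_le_frobenius_sq_sub hk hkr hA

end EckartYoung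

/-! ### Oblique projections and the error for a fixed set of columns -/

theorem principalMinor_mul_transpose_nonneg {d k : ℕ} (W : Matrix (Fin d) (Fin k) ℝ)
    (S : Finset (Fin d)) : 0 ≤ principalMinor (W * Wᵀ) S := by
  rw [principalMinor_def]
  have := (posSemidef_self_mul_conjTranspose
    (W.submatrix (fun i : S => (i : Fin d)) id)).det_nonneg
  rwa [conjTranspose_eq_transpose_of_trivial] at this

/-- The oblique projection `P = C B` onto the coordinates in `S`, along the kernel of `Wᵀ`. -/
theorem exists_oblique_projection {d k : ℕ} {W : Matrix (Fin d) (Fin k) ℝ} (hW : Wᵀ * W = 1)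
    {S : Finset (Fin d)} (hS : S.card = k) (h0 : principalMinor (W * Wᵀ) S ≠ 0) :
    ∃ B : Matrix S (Fin d) ℝ, ∃ P : Matrix (Fin d) (Fin d) ℝ,
      P = (1 : Matrix (Fin d) (Fin d) ℝ).submatrix id (fun i : S => (i : Fin d)) * B ∧
      P * P = P ∧ W * Wᵀ * P = W * Wᵀ ∧
      principalMinor (W * Wᵀ) S * (Pᵀ * P).trace = ((W * Wᵀ).submatrix
        (fun i : S => (i : Fin d)) (fun i : S => (i : Fin d))).adjugate.trace := by
  rw [principalMinor_def] at h0 ⊢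
  set C : Matrix (Fin d) S ℝ := (1 : Matrix (Fin d) (Fin d) ℝ).submatrix id (fun i : S => i)
  set Y : Matrix S (Fin k) ℝ := W.submatrix (fun i : S => i) id with hY
  have hK : (W * Wᵀ).submatrix (fun i : S => (i : Fin d)) (fun i : S => (i : Fin d)) = Y * Yᵀ := rfl
  rw [hK] at h0 ⊢
  have hu : IsUnit (Y * Yᵀ).det := isUnit_iff_ne_zero.2 h0
  have hC : Cᵀ * W = Y := by
    ext i j
    simp [C, hY, mul_apply, one_apply]
  have hC' : Wᵀ * C = Yᵀ := by rw [← hC]; simp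
  have hCC : Cᵀ * C = 1 := by
    have : Cᵀ * C = ((1 : Matrix (Fin d) (Fin d) ℝ)ᵀ * 1).submatrix (fun i : S => (i : Fin d))
      (fun i : S => (i : Fin d)) := rfl
    rw [this, Matrix.mul_one, transpose_one, submatrix_one _ Subtype.val_injective]
  -- As |S| = k, Y is square up to reindexing, so a one-sided inverse is two-sided. Thus (Y Yᵀ)⁻¹ Y
  -- inverts Yᵀ = WᵀC, and `B` below is (WᵀC)⁻¹ Wᵀ.
  have hYY : Yᵀ * ((Y * Yᵀ)⁻¹ * Y) = 1 := by
    have e : S ≃ Fin k := Fintype.equivFinOfCardEq (by simp [hS])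
    have := Matrix.mul_nonsing_inv _ hu
    rw [Matrix.mul_assoc, mul_eq_one_comm_of_equiv e, Matrix.mul_assoc] at this
    exact this
  set B : Matrix S (Fin d) ℝ := (Y * Yᵀ)⁻¹ * Y * Wᵀ with hB
  have hBC : B * C = 1 := by
    rw [hB, Matrix.mul_assoc, hC', Matrix.mul_assoc, Matrix.nonsing_inv_mul _ hu]
  refine ⟨B, C * B, rfl, ?_, ?_, ?_⟩
  · rw [Matrix.mul_assoc, ← Matrix.mul_assoc B, hBC, Matrix.one_mul]
  · rw [Matrix.mul_assoc W, ← Matrix.mul_assoc Wᵀ, hC', hB, ← Matrix.mul_assoc Yᵀ, hYY,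
      Matrix.one_mul]
  · have h1 : B * Bᵀ = (Y * Yᵀ)⁻¹ᵀ := by
      have : B * Bᵀ = (Y * Yᵀ)⁻¹ * (Y * (Wᵀ * W) * Yᵀ) * (Y * Yᵀ)⁻¹ᵀ := by
        rw [hB]
        simp only [transpose_mul, transpose_transpose, Matrix.mul_assoc]
      rw [this, hW, Matrix.mul_one, Matrix.nonsing_inv_mul _ hu, Matrix.one_mul]
    have h2 : (C * B)ᵀ * (C * B) = Bᵀ * (Cᵀ * C * B) := by
      simp only [transpose_mul, Matrix.mul_assoc]
    rw [h2, hCC, Matrix.one_mul, trace_mul_comm, h1, trace_transpose, Matrix.inv_def, trace_smul,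
      Ring.inverse_eq_inv', smul_eq_mul, mul_inv_cancel_left₀ h0]

theorem colSubmatrix_eq_mul {N d : ℕ} (X : Matrix (Fin N) (Fin d) ℝ) (S : Finset (Fin d)) :
    colSubmatrix X S =
      X * (1 : Matrix (Fin d) (Fin d) ℝ).submatrix id (fun i : S => (i : Fin d)) := by
  ext i j
  simp [colSubmatrix, mul_apply, one_apply]

/-- The error of a best approximation from the columns in `S`, weighted by the probability of
`S`. -/
theorem principalMinor_mul_columnError_le {N d k : ℕ} {X : Matrix (Fin N) (Fin d) ℝ}
    {W : Matrix (Fin d) (Fin k) ℝ} (hW : Wᵀ * W = 1) (hk : 1 ≤ k) {ν : NormKind}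
    {S : Finset (Fin d)} (hS : S.card = k) {A : Matrix (Fin N) (Fin d) ℝ}
    (hA : IsBestColumnApprox ν k X S A) :
    principalMinor (W * Wᵀ) S * matNorm ν (X - A) ^ 2 ≤ ((W * Wᵀ).submatrix
      (fun i : S => (i : Fin d)) (fun i : S => (i : Fin d))).adjugate.trace *
        matNorm ν (X - X * (W * Wᵀ)) ^ 2 := by
  -- For a set of weight zero the oblique projection is unavailable, but the right side is still
  -- nonnegative.
  by_cases h0 : principalMinor (W * Wᵀ) S = 0
  · rw [h0, zero_mul, trace_adjugate_submatrix]
    exact mul_nonneg (Finset.sum_nonneg fun i _ => principalMinor_mul_transpose_nonneg W _)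
      (sq_nonneg _)
  obtain ⟨B, P, hPB, hPP, hKP, htr⟩ := exists_oblique_projection hW hS h0
  -- If P = 0 then W Wᵀ = 0, although its trace is k ≥ 1.
  have hP0 : P ≠ 0 := by
    rintro rfl
    rw [Matrix.mul_zero] at hKP
    have := congrArg trace hKP
    rw [trace_zero, trace_mul_comm, hW, trace_one, Fintype.card_fin] at this
    have : k = 0 := by exact_mod_cast this.symm
    omega
  have h1 : matNorm ν (X - A) ^ 2 ≤ matNorm ν (X - X * P) ^ 2 := by
    have := hA.2 B ((B.rank_le_card_height).trans (by simp [hS]))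
    rw [colSubmatrix_eq_mul, Matrix.mul_assoc, ← hPB] at this
    exact pow_le_pow_left₀ (matNorm_nonneg _ _) this 2
  have h2 : X - X * P = (X - X * (W * Wᵀ)) * (1 - P) := by
    rw [Matrix.mul_sub, Matrix.sub_mul _ _ P, Matrix.mul_assoc X, hKP, Matrix.mul_one]
    abel
  have h3 : matNorm .spectral (1 - P) ^ 2 ≤ (Pᵀ * P).trace :=
    (spectral_sq_one_sub_le hPP hP0).trans
      ((spectral_sq_le_frobenius_sq P).trans_eq (frobenius_sq P))
  rw [← htr, mul_assoc]
  refine mul_le_mul_of_nonneg_left ?_ (principalMinor_mul_transpose_nonneg W S)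
  rw [h2] at h1
  refine h1.trans ((matNorm_sq_mul_le _ _ _).trans ?_)
  rw [mul_comm]
  exact mul_le_mul_of_nonneg_right h3 (sq_nonneg _)

/-! ### Existence and uniqueness of the process, and the expected error -/

theorem projectionWeight_nonneg {d k : ℕ} (W : Matrix (Fin d) (Fin k) ℝ) (S : Finset (Fin d)) :
    0 ≤ projectionWeight W S := by
  unfold projectionWeight
  split_ifs
  · exact principalMinor_mul_transpose_nonneg W S
  · exact le_rfl

/-- The determinantal point processes of kernel `W Wᵀ` are the probability distributions of
weights `projectionWeight W`. -/
theorem isDPP_iff_toReal_eq {d k : ℕ} {W : Matrix (Fin d) (Fin k) ℝ} (hW : Wᵀ * W = 1)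
    (p : PMF (Finset (Fin d))) :
    IsDPP p (W * Wᵀ) ↔ ∀ S, (p S).toReal = projectionWeight W S := by
  unfold IsDPP
  simp_rw [← principalMinor_def, ← sum_filter_superset_projectionWeight hW]
  exact ⟨fun h => congrFun (eq_of_sum_superset_eq h), fun h S => by simp_rw [h]⟩

theorem exists_isDPP_projection {d k : ℕ} {W : Matrix (Fin d) (Fin k) ℝ} (hW : Wᵀ * W = 1) :
    ∃ p : PMF (Finset (Fin d)), IsDPP p (W * Wᵀ) := by
  refine ⟨PMF.ofFintype (fun S => ENNReal.ofReal (projectionWeight W S)) ?_, ?_⟩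
  · rw [← ENNReal.ofReal_sum_of_nonneg fun S _ => projectionWeight_nonneg W S]
    have := sum_projectionWeight_mul W 1
    simp only [Pi.one_apply, mul_one] at this
    rw [this, sum_principalMinor_projection hW]
    simp
  · rw [isDPP_iff_toReal_eq hW]
    intro S
    rw [PMF.ofFintype_apply, ENNReal.toReal_ofReal (projectionWeight_nonneg W S)]

end

theorem mainTheorem1 {N d r k : ℕ} (X : Matrix (Fin N) (Fin d) ℝ)
    (U : Matrix (Fin N) (Fin r) ℝ) (σ : Fin r → ℝ) (V : Matrix (Fin d) (Fin r) ℝ)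
    (hSVD : IsSVD X U σ V) (hk : 1 ≤ k) (hkr : k ≤ r) :
    (∃ p : PMF (Finset (Fin d)), IsDPP p (firstCols hkr V * (firstCols hkr V).transpose)) ∧
    ∀ p : PMF (Finset (Fin d)), IsDPP p (firstCols hkr V * (firstCols hkr V).transpose) →
      (∀ S : Finset (Fin d), S.card ≠ k → p S = 0) ∧
      (∀ (S : Finset (Fin d)) (hS : S.card = k),
        (p S).toReal = (rowSubmatrix (firstCols hkr V) S hS).det ^ 2) ∧
      ∀ (ν μ : NormKind) (Xk : Matrix (Fin N) (Fin d) ℝ)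
        (XS : Finset (Fin d) → Matrix (Fin N) (Fin d) ℝ),
        IsBestRankApprox μ k X Xk →
        (∀ S : Finset (Fin d), S.card = k → IsBestColumnApprox ν k X S (XS S)) →
        expectation p (fun S => matNorm ν (X - XS S) ^ 2) ≤
          (k : ℝ) * ((d : ℝ) + 1 - (k : ℝ)) * matNorm ν (X - Xk) ^ 2 := by
  have hW := firstCols_orthonormal hkr hSVD.orthonormal_right
  refine ⟨exists_isDPP_projection hW, fun p hp => ?_⟩
  rw [isDPP_iff_toReal_eq hW] at hp
  refine ⟨fun S hS => ?_, fun S hS => ?_, fun ν μ Xk XS hXk hXS => ?_⟩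
  · have := hp S
    rw [projectionWeight, if_neg hS, ENNReal.toReal_eq_zero_iff] at this
    exact this.resolve_right (p.apply_ne_top S)
  · rw [hp, projectionWeight, if_pos hS, sq_det_rowSubmatrix]
  -- The truncation is optimal in ν against every matrix of rank at most k, so μ and ν need not
  -- agree.
  · have hEY := hSVD.sub_truncation_le hk hkr ν hXk.1
    unfold expectation
    simp_rw [hp]
    -- With the constant written as the sum of the adjugate traces, the bound is compared set by
    -- set.
    rw [sum_projectionWeight_mul, ← sum_trace_adjugate_projection hW hk, Finset.sum_mul]
    refine Finset.sum_le_sum fun S hS => ?_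
    have hS' := (Finset.mem_powersetCard.1 hS).2
    refine (principalMinor_mul_columnError_le hW hk hS' (hXS S hS')).trans
      (mul_le_mul_of_nonneg_left hEY ?_)
    rw [trace_adjugate_submatrix]
    exact Finset.sum_nonneg fun i _ => principalMinor_mul_transpose_nonneg _ _
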